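/- Let $\Sigma$ (constants) and $\mathcal{X}$ (variables) be disjoint finite sets and $\Omega = \Sigma\cup\mathcal{X}$. A word equation over $\Omega^+$ is a pair $(U,V)\in\Omega^+\times\Omega^+$, written $U=V$; it is quadratic if every $X\in\mathcal{X}$ occurs at most twice in $UV$. Given a homomorphism $\mu:\Omega^+\to S$ to a finite semigroup $S$ (a constraint), a solution of $(U=V,\mu)$ is a mapping $\sigma:\mathcal{X}\to\Sigma^+$ whose extension to a homomorphism $\Omega^+\to\Sigma^+$ fixing $\Sigma$ satisfies $\sigma(U)=\sigma(V)$ and $\mu(\sigma(X))=\mu(X)$ for all $X\in\mathcal{X}$. The exponent of periodicity $\exp(w)$ of a word $w$ is the greatest $n$ such that $w=u\,p^n\,v$ for some words $u,v$ and some nonempty word $p$; one puts $\exp(\sigma)=\max_{X\in\mathcal{X}}\exp(\sigma(X))$, and $\exp(U=V,\mu)\in\mathbb{N}\cup\{\infty\}$ is the supremum of $\exp(\sigma)$ over all solutions $\sigma$. A finite semigroup $S$ is nice for a family $\mathcal{E}$ of word equations if, for every equation $U=V$ in $\mathcal{E}$ and every constraint $\mu:\Omega^+\to S$, the following holds: if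 $(U=V,\mu)$ has infinitely many solutions, then $\exp(U=V,\mu)=\infty$. For a finite semigroup $S$, let $S^1$ be $S$ with a neutral element adjoined (if necessary), let $u^\omega$ be the idempotent power of $u\in S^1$, let $x\sim_{\mathcal L}y$ mean $S^1x=S^1y$ and $x\sim_{\mathcal J}y$ mean $S^1xS^1=S^1yS^1$, and let $\operatorname{stab}_{\mathcal L}(x)=\{u\in S^1: u^\omega x=x\}$. The class $\mathbf{DLG}$ consists of the finite semigroups $S$ such that for all $x,y\in S$ and $u,v\in S^1$: (1) if $u,v\in\operatorname{stab}_{\mathcal L}(x)$, then $uv\in\operatorname{stab}_{\mathcal L}(x)$; (2) if $x\sim_{\mathcal J}y$, then $\operatorname{stab}_{\mathcal L}(x)=\operatorname{stab}_{\mathcal L}(y)$; (3) if $ux\sim_{\mathcal L}x$, then $u\in\operatorname{stab}_{\mathcal L}(x)$. Let $B_2=\{a,b,ab,ba,0\}$ be the (combinatorial) Brandt semigroup, the five-element semigroup with zero $0$ whose multiplication is determined by $aba=a$, $bab=b$, $a^2=b^2=0$. Then $B_2\notin\mathbf{DLG}$, and $B_2$ is nice for the family of all quadratic word equations over an alphabet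 of constants $\Sigma$ with $|\Sigma|\le 2$. -/

import Mathlib

universe u v w

namespace WordEq

/-! ### Words, word equations with constraints, solutions -/

/-- The letters of a nonempty word, as a list. -/
def letters {A : Type*} (w : FreeSemigroup A) : List A := w.head :: w.tail

/-- A word equation `U = V` over `(C ∪ X)⁺`, where `C` is the alphabet of constants and `X` is the
set of variables. -/
structure WordEquation (C : Type*) (X : Type*) where
  lhs : FreeSemigroup (C ⊕ X)
  rhs : FreeSemigroup (C ⊕ X)

/-- The extension of `σ : X → C⁺` to a morphism `(C ∪ X)⁺ → C⁺` leaving the constants invariant. -/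
def extend {C X : Type*} (σ : X → FreeSemigroup C) : FreeSemigroup (C ⊕ X) →ₙ* FreeSemigroup C :=
  FreeSemigroup.lift (Sum.elim FreeSemigroup.of σ)

/-- The set of solutions of the word equation `E` with constraint `μ : (C ∪ X)⁺ → S`: mappings
`σ : X → C⁺` with `σ(U) = σ(V)` and `μ(σ(x)) = μ(x)` for every variable `x`. -/
def Sol {C X S : Type*} [Semigroup S] (E : WordEquation C X) (μ : FreeSemigroup (C ⊕ X) →ₙ* S) :
    Set (X → FreeSemigroup C) :=
  {σ | extend σ E.lhs = extend σ E.rhs ∧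
    ∀ x : X, μ (FreeSemigroup.map Sum.inl (σ x)) = μ (FreeSemigroup.of (Sum.inr x))}

/-! ### Exponent of periodicity -/

/-- The exponent of periodicity of a word `w`: the greatest `n` such that `w = u pⁿ v` with `p`
nonempty. (Such `n` are at most the length of `w`, so the supremum is a maximum.) -/
noncomputable def wordExp {C : Type*} (w : FreeSemigroup C) : ℕ∞ :=
  ⨆ n ∈ {n : ℕ | ∃ u p v : List C, p ≠ [] ∧ letters w = u ++ (List.replicate n p).flatten ++ v},
    (n : ℕ∞)

/-- The exponent of periodicity of a solution: the maximum of those of the words `σ x`. -/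
noncomputable def solExp {C X : Type*} (σ : X → FreeSemigroup C) : ℕ∞ :=
  ⨆ x : X, wordExp (σ x)

/-- The exponent of periodicity of an equation with constraint: the supremum over all solutions. -/
noncomputable def eqExp {C X S : Type*} [Semigroup S] (E : WordEquation C X)
    (μ : FreeSemigroup (C ⊕ X) →ₙ* S) : ℕ∞ :=
  ⨆ σ ∈ Sol E μ, solExp σ

/-! ### Families of equations and nice semigroups -/

/-- A family of word equations, over varying sets of constants and variables. -/
abbrev EquationFamily : Type (max u v + 1) :=
  ∀ (C : Type u) (X : Type v), Set (WordEquation C X)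

/-- A finite semigroup `S` is nice for the family `F` if every equation of `F` (over finite sets of
constants and variables) with constraint in `S` that has infinitely many solutions has an infinite
exponent of periodicity. -/
def IsNice (S : Type w) [Semigroup S] [Finite S] (F : EquationFamily.{u, v}) : Prop :=
  ∀ (C : Type u) (X : Type v) [Finite C] [Finite X], ∀ E ∈ F C X,
    ∀ μ : FreeSemigroup (C ⊕ X) →ₙ* S, (Sol E μ).Infinite → eqExp E μ = ⊤

open Classical in
/-- An equation is quadratic if every variable occurs at most twice in it (both sides together). -/
def WordEquation.IsQuadratic {C X : Type*} (E : WordEquation C X) : Prop :=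
  ∀ x : X, (letters E.lhs).count (Sum.inr x) + (letters E.rhs).count (Sum.inr x) ≤ 2

/-- The quadratic word equations over an alphabet of at most two constants. -/
def quadraticTwoConstants : EquationFamily.{u, v} :=
  fun C _ => {E | E.IsQuadratic ∧ ENat.card C ≤ 2}

/-! ### Green's relations and the class DLG. Here `S¹` is `WithOne S`. -/

/-- `x ∼ y` for Green's relation `L`, that is, `S¹x = S¹y`. -/
def GreenL {S : Type*} [Semigroup S] (x y : S) : Prop :=
  Set.range (fun s : WithOne S => s * (x : WithOne S)) =
    Set.range (fun s : WithOne S => s * (y : WithOne S))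

/-- `x ∼ y` for Green's relation `J`, that is, `S¹xS¹ = S¹yS¹`. -/
def GreenJ {S : Type*} [Semigroup S] (x y : S) : Prop :=
  Set.range (fun s : WithOne S × WithOne S => s.1 * (x : WithOne S) * s.2) =
    Set.range (fun s : WithOne S × WithOne S => s.1 * (y : WithOne S) * s.2)

/-- Every element of a finite monoid has an idempotent positive power. -/
theorem exists_idempotent_pow {M : Type*} [Monoid M] [Finite M] (u : M) :
    ∃ n : ℕ, 0 < n ∧ IsIdempotentElem (u ^ n) := by
  obtain ⟨i, j, hij, h⟩ := Finite.exists_ne_map_eq_of_infinite (fun n : ℕ => u ^ n)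
  wlog hlt : i < j generalizing i j
  · exact this j i hij.symm h.symm (by omega)
  obtain ⟨d, rfl⟩ := Nat.exists_eq_add_of_lt hlt
  have key : ∀ k m, i ≤ m → u ^ (m + k * (d + 1)) = u ^ m := by
    intro k
    induction k with
    | zero => simp
    | succ k ih =>
      intro m hm
      have hk := ih m hm
      obtain ⟨r, rfl⟩ := Nat.exists_eq_add_of_le hm
      rw [show i + r + (k + 1) * (d + 1) = (i + d + 1) + (r + k * (d + 1)) by ring, pow_add, ← h,
        ← pow_add, ← hk]
      congr 1
      ring
  refine ⟨(i + 1) * (d + 1), by positivity, ?_⟩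
  rw [IsIdempotentElem, ← pow_add]
  exact key (i + 1) _ (by nlinarith)

/-- The idempotent power `u ^ ω` of an element of a finite monoid. -/
noncomputable def omegaPow {M : Type*} [Monoid M] (u : M) : M :=
  u ^ sInf {n : ℕ | 0 < n ∧ IsIdempotentElem (u ^ n)}

/-- `stab_L(x)`, the set of all `u ∈ S¹` with `u ^ ω x = x`. -/
def lStab {S : Type*} [Semigroup S] (x : S) : Set (WithOne S) :=
  {u | omegaPow u * (x : WithOne S) = (x : WithOne S)}

/-- The class DLG of finite semigroups. -/
structure IsDLG (S : Type*) [Semigroup S] [Finite S] : Prop where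
  mul_mem : ∀ (x : S) (u v : WithOne S), u ∈ lStab x → v ∈ lStab x → u * v ∈ lStab x
  eq_of_greenJ : ∀ x y : S, GreenJ x y → lStab x = lStab y
  mem_of_greenL : ∀ (x y : S) (u : WithOne S),
    u * (x : WithOne S) = (y : WithOne S) → GreenL y x → u ∈ lStab x

/-! ### The Brandt semigroup -/

/-- The elements of the combinatorial Brandt semigroup. -/
inductive B2 : Type
  | a | b | ab | ba | zero
  deriving DecidableEq

namespace B2

instance : Fintype B2 where
  elems := {a, b, ab, ba, zero}
  complete := by
    intro x
    cases x <;> decide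

/-- The multiplication determined by `aba = a`, `bab = b`, `a² = b² = 0`, with `0` a zero. -/
def mul : B2 → B2 → B2
  | a, b => ab
  | a, ba => a
  | b, a => ba
  | b, ab => b
  | ab, a => a
  | ab, ab => ab
  | ba, b => b
  | ba, ba => ba
  | _, _ => zero

instance : Semigroup B2 where
  mul := mul
  mul_assoc := by
    intro x y z
    cases x <;> cases y <;> cases z <;> rfl

/-- The defining relations. -/
theorem relations : a * b = ab ∧ b * a = ba ∧ a * b * a = a ∧ b * a * b = b ∧
    a * a = zero ∧ b * b = zero ∧ ∀ x : B2, x * zero = zero ∧ zero * x = zero := by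
  decide

end B2

end WordEq

/-! Niceness rests on a dichotomy for the constraint. If all constants have the same nonzero
idempotent image, the constraint is void as soon as there is a solution. Otherwise, viewing `B2` as
the matrix units of size two together with 0, a word over at most two letters with nonzero image is
alternating except perhaps at its ends, so a long one contains a high power. The words with image 0
then form an ideal `I` outside which only finitely many words avoid `k`-th powers
(`isCothinIdeal_brandtProd`).

Suppose the exponents are bounded. A variable with nonzero image then takes finitely many values and
can be fixed, leaving a quadratic equation whose variables range over `I`. `explodes_of_quadraticOn`
treats it by Nielsen transformations. If `x U = y V` and `y` is a prefix of `x`, write `x = y w`.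
For `w` in `I`, substitute `y x` for `x`; for `w` outside `I` there are only finitely many choices,
and each of them eliminates `x`. If a leading variable recurs on the other side, the equation can be
pumped directly. Termination is lexicographic in the number of variables, the length and the number
of variables occurring twice on one side, with an inner induction when a leading variable occurs
twice on its own side.

In `listSol`, sending inactive variables to the empty word keeps them from contributing to the
number of solutions.

`B2` is not in DLG because `ba` and `a` are L-equivalent although the idempotent power of `b` is 0.
-/

namespace WordEq

open Function

/-! ### Substitution and occurrence counts for words with variables. -/

section Lists

variable {C : Type u} {X : Type v}

/-- The image of a word over constants and variables under an assignment of (possibly empty) words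
to the variables. -/
def evalWord (σ : X → List C) (w : List (C ⊕ X)) : List C :=
  w.flatMap (Sum.elim (fun c => [c]) σ)

@[simp] theorem evalWord_nil (σ : X → List C) : evalWord σ [] = [] := rfl

@[simp] theorem evalWord_inl_cons (σ : X → List C) (c : C) (w : List (C ⊕ X)) :
    evalWord σ (Sum.inl c :: w) = c :: evalWord σ w := by
  simp [evalWord]

@[simp] theorem evalWord_inr_cons (σ : X → List C) (x : X) (w : List (C ⊕ X)) :
    evalWord σ (Sum.inr x :: w) = σ x ++ evalWord σ w := by
  simp [evalWord]

@[simp] theorem evalWord_append (σ : X → List C) (v w : List (C ⊕ X)) :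
    evalWord σ (v ++ w) = evalWord σ v ++ evalWord σ w := by
  simp [evalWord]

theorem evalWord_cons (σ : X → List C) (l : C ⊕ X) (w : List (C ⊕ X)) :
    evalWord σ (l :: w) = evalWord σ [l] ++ evalWord σ w := by
  simp [evalWord]

@[simp] theorem evalWord_map_inl (σ : X → List C) (w : List C) :
    evalWord σ (w.map Sum.inl) = w := by
  induction w with
  | nil => rfl
  | cons c w ih => simp [ih]

theorem evalWord_congr {σ τ : X → List C} {w : List (C ⊕ X)}
    (h : ∀ x, Sum.inr x ∈ w → σ x = τ x) : evalWord σ w = evalWord τ w := by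
  induction w with
  | nil => rfl
  | cons l w ih =>
    have ih := ih fun x hx => h x (by simp [hx])
    rcases l with c | x
    · simp [ih]
    · simp [ih, h x]

open Classical in
theorem evalWord_update_of_notMem {σ : X → List C} {w : List (C ⊕ X)} {x : X} (v : List C)
    (h : Sum.inr x ∉ w) : evalWord (update σ x v) w = evalWord σ w :=
  evalWord_congr fun z hz => update_of_ne (by rintro rfl; exact h hz) _ _

open Classical in
/-- Replace every occurrence of the variable `x` by the word `r`. -/
noncomputable def substWord (x : X) (r : List (C ⊕ X)) (w : List (C ⊕ X)) : List (C ⊕ X) :=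
  w.flatMap fun l => if l = Sum.inr x then r else [l]

open Classical in
theorem substWord_cons (x : X) (r : List (C ⊕ X)) (l : C ⊕ X) (w : List (C ⊕ X)) :
    substWord x r (l :: w) = (if l = Sum.inr x then r else [l]) ++ substWord x r w := by
  simp [substWord]

theorem substWord_of_notMem {x : X} {r w : List (C ⊕ X)} (h : Sum.inr x ∉ w) :
    substWord x r w = w := by
  induction w with
  | nil => rfl
  | cons l w ih =>
    rw [List.mem_cons, not_or] at h
    rw [substWord_cons, ih h.2, if_neg (Ne.symm h.1)]
    rfl

open Classical in
theorem evalWord_substWord (σ : X → List C) (x : X) (r w : List (C ⊕ X)) :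
    evalWord σ (substWord x r w) = evalWord (update σ x (evalWord σ r)) w := by
  induction w with
  | nil => rfl
  | cons l w ih =>
    rw [substWord_cons, evalWord_append, ih]
    rcases l with c | z
    · simp
    · by_cases h : z = x
      · subst h; simp
      · simp [h]

open Classical in
/-- The number of occurrences of the letter `l` in `w`. -/
noncomputable def occ (l : C ⊕ X) (w : List (C ⊕ X)) : ℕ := w.countP fun m => decide (m = l)

@[simp] theorem occ_nil (l : C ⊕ X) : occ l [] = 0 := rfl

open Classical in
theorem occ_cons (l m : C ⊕ X) (w : List (C ⊕ X)) :
    occ l (m :: w) = occ l w + if m = l then 1 else 0 := by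
  simp [occ, List.countP_cons]

@[simp] theorem occ_cons_self (l : C ⊕ X) (w : List (C ⊕ X)) : occ l (l :: w) = occ l w + 1 := by
  simp [occ_cons]

theorem occ_cons_of_ne {l m : C ⊕ X} (h : m ≠ l) (w : List (C ⊕ X)) :
    occ l (m :: w) = occ l w := by
  simp [occ_cons, h]

@[simp] theorem occ_append (l : C ⊕ X) (v w : List (C ⊕ X)) :
    occ l (v ++ w) = occ l v + occ l w := by
  simp [occ]

@[simp] theorem occ_map_inl (x : X) (w : List C) : occ (Sum.inr x) (w.map Sum.inl) = 0 := by
  simp [occ]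

theorem occ_eq_zero {l : C ⊕ X} {w : List (C ⊕ X)} : occ l w = 0 ↔ l ∉ w := by
  simp only [occ, List.countP_eq_zero, decide_eq_true_eq]
  exact ⟨fun h hl => h l hl rfl, fun h m hm hml => h (hml ▸ hm)⟩

open Classical in
theorem occ_substWord (x : X) (r w : List (C ⊕ X)) (l : C ⊕ X) :
    occ l (substWord x r w) =
      (if l = Sum.inr x then 0 else occ l w) + occ (Sum.inr x) w * occ l r := by
  induction w with
  | nil => simp [substWord]
  | cons m w ih =>
    rw [substWord_cons, occ_append, ih]
    by_cases hm : m = Sum.inr x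
    · subst hm
      by_cases hl : l = Sum.inr x
      · subst hl; simp; ring
      · simp [hl, occ_cons_of_ne (Ne.symm hl)]; ring
    · by_cases hl : l = Sum.inr x
      · subst hl; simp [hm, occ_cons]
      · simp [hl, hm, occ_cons]; ring

theorem length_substWord (x : X) (r w : List (C ⊕ X)) :
    (substWord x r w).length + occ (Sum.inr x) w =
      w.length + occ (Sum.inr x) w * r.length := by
  induction w with
  | nil => simp [substWord]
  | cons m w ih =>
    rw [substWord_cons, List.length_append]
    by_cases hm : m = Sum.inr x
    · subst hm
      simp only [if_true, occ_cons_self, List.length_cons]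
      nlinarith
    · simp only [hm, if_false, List.length_cons, List.length_nil, occ_cons_of_ne hm]
      omega

/-! ### Powers, cothin ideals and the basic pumping and substitution steps. -/

/-- The word `w` contains a `k`-th power of a nonempty word as a factor. -/
def HasPower (k : ℕ) (w : List C) : Prop :=
  ∃ u p v : List C, p ≠ [] ∧ w = u ++ (List.replicate k p).flatten ++ v

theorem HasPower.of_infix {k : ℕ} {v w : List C} (h : HasPower k v) (hvw : v <:+: w) :
    HasPower k w := by
  obtain ⟨u, p, t, hp, rfl⟩ := h
  obtain ⟨s, r, rfl⟩ := hvw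
  exact ⟨s ++ u, p, t ++ r, hp, by simp [List.append_assoc]⟩

/-- Among the assignments in `T` there are arbitrarily large exponents of periodicity. -/
def UnboundedPowers (T : Set (X → List C)) : Prop :=
  ∀ k, ∃ σ ∈ T, ∃ x, HasPower k (σ x)

/-- Undoing a substitution only lengthens the values, so powers survive as factors. -/
theorem UnboundedPowers.of_mapsTo {T T' : Set (X → List C)} (h : UnboundedPowers T)
    (f : (X → List C) → X → List C) (hf : ∀ σ ∈ T, f σ ∈ T')
    (hinfix : ∀ σ ∈ T, ∀ x, σ x <:+: f σ x) : UnboundedPowers T' := by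
  intro k
  obtain ⟨σ, hσ, x, hx⟩ := h k
  exact ⟨f σ, hf σ hσ, x, hx.of_infix (hinfix σ hσ x)⟩

/-- A two-sided ideal of the semigroup of nonempty words such that only finitely many words outside
it avoid `k`-th powers, for every `k`. -/
structure IsCothinIdeal (I : Set (List C)) : Prop where
  nil_notMem : [] ∉ I
  append_left : ∀ u, ∀ w ∈ I, u ++ w ∈ I
  append_right : ∀ w ∈ I, ∀ v, w ++ v ∈ I
  finite_compl : ∀ k, {w | w ∉ I ∧ ¬ HasPower k w}.Finite

/-- The solutions of the equation `U = V` that map the variables in `A` into `I` and the others to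
the empty word. -/
def listSol (I : Set (List C)) (A : Finset X) (U V : List (C ⊕ X)) : Set (X → List C) :=
  {σ | (∀ x ∈ A, σ x ∈ I) ∧ (∀ x ∉ A, σ x = []) ∧ evalWord σ U = evalWord σ V}

theorem listSol_comm (I : Set (List C)) (A : Finset X) (U V : List (C ⊕ X)) :
    listSol I A U V = listSol I A V U := by
  ext σ; simp only [listSol, Set.mem_ofPred_eq, eq_comm]

theorem listSol_cons_cons (I : Set (List C)) (A : Finset X) (l : C ⊕ X) (U V : List (C ⊕ X)) :
    listSol I A (l :: U) (l :: V) = listSol I A U V := by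
  ext σ
  simp only [listSol, Set.mem_ofPred_eq]
  rw [evalWord_cons σ l U, evalWord_cons σ l V, List.append_right_inj]

/-- If the equation has infinitely many solutions in `I`, their exponents are unbounded. -/
def Explodes (I : Set (List C)) (A : Finset X) (U V : List (C ⊕ X)) : Prop :=
  (listSol I A U V).Infinite → UnboundedPowers (listSol I A U V)

theorem Explodes.symm {I : Set (List C)} {A : Finset X} {U V : List (C ⊕ X)}
    (h : Explodes I A U V) : Explodes I A V U := by
  unfold Explodes at *
  rwa [listSol_comm]

open Classical in
-- The value of an absent variable is arbitrary in `I`, and `I` is closed under raising it to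
-- powers.
theorem unboundedPowers_of_free {I : Set (List C)} (hI : IsCothinIdeal I) {A : Finset X}
    {U V : List (C ⊕ X)} {x : X} (hx : x ∈ A) (hU : Sum.inr x ∉ U) (hV : Sum.inr x ∉ V)
    (hne : (listSol I A U V).Nonempty) : UnboundedPowers (listSol I A U V) := by
  obtain ⟨σ, hσA, hσ, hE⟩ := hne
  intro k
  refine ⟨update σ x ((List.replicate k (σ x)).flatten ++ σ x), ⟨fun z hz => ?_, fun z hz => ?_, ?_⟩,
    x, [], σ x, σ x, fun h => hI.nil_notMem (h ▸ hσA x hx), by simp⟩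
  · by_cases hzx : z = x
    · subst hzx; simpa using hI.append_left _ _ (hσA z hz)
    · simpa [hzx] using hσA z hz
  · rw [update_of_ne (by rintro rfl; exact hz hx), hσ z hz]
  · rwa [evalWord_update_of_notMem _ hU, evalWord_update_of_notMem _ hV]

open Classical in
/-- An equation `x U = W x V` with no other occurrence of `x` is invariant under `x ↦ W x`. -/
theorem unboundedPowers_of_opposite {I : Set (List C)} (hI : IsCothinIdeal I) {A : Finset X}
    {U V W : List (C ⊕ X)} {x : X} (hx : x ∈ A) (hU : Sum.inr x ∉ U) (hV : Sum.inr x ∉ V)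
    (hW : Sum.inr x ∉ W) (hWI : ∀ σ ∈ listSol I A (Sum.inr x :: U) (W ++ Sum.inr x :: V),
      evalWord σ W ≠ [])
    (hne : (listSol I A (Sum.inr x :: U) (W ++ Sum.inr x :: V)).Nonempty) :
    UnboundedPowers (listSol I A (Sum.inr x :: U) (W ++ Sum.inr x :: V)) := by
  obtain ⟨σ, hσA, hσ, hE⟩ := id hne
  intro k
  refine ⟨update σ x ((List.replicate k (evalWord σ W)).flatten ++ σ x),
    ⟨fun z hz => ?_, fun z hz => ?_, ?_⟩,
    x, [], evalWord σ W, σ x, hWI σ ⟨hσA, hσ, hE⟩, by simp⟩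
  · by_cases hzx : z = x
    · subst hzx; simpa using hI.append_left _ _ (hσA z hz)
    · simpa [hzx] using hσA z hz
  · rw [update_of_ne (by rintro rfl; exact hz hx), hσ z hz]
  · simp only [evalWord_inr_cons, evalWord_append, update_self, evalWord_update_of_notMem _ hU,
      evalWord_update_of_notMem _ hV, evalWord_update_of_notMem _ hW] at hE ⊢
    rw [List.append_assoc, hE]
    simp only [← List.append_assoc]
    congr 2
    have := List.replicate_succ' (n := k) (a := evalWord σ W)
    rw [← List.flatten_concat, ← List.flatten_cons]
    congr 1
    exact (this.symm.trans List.replicate_succ)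

open Classical in
/-- Substituting `y r` for `x` in `x U = y V`, where `x` does not occur in `V`. -/
theorem evalWord_update_eq_iff {τ : X → List C} {U V r : List (C ⊕ X)} {x : X} {y : C ⊕ X}
    (hyx : y ≠ Sum.inr x) (hV : Sum.inr x ∉ V) :
    evalWord (update τ x (evalWord τ (y :: r))) (Sum.inr x :: U) =
      evalWord (update τ x (evalWord τ (y :: r))) (y :: V) ↔
    evalWord τ (r ++ substWord x (y :: r) U) = evalWord τ V := by
  rw [← evalWord_substWord, ← evalWord_substWord, substWord_cons, if_pos rfl,
    substWord_of_notMem (w := y :: V) (by simp [hV, Ne.symm hyx]), List.cons_append,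
    evalWord_cons τ y, evalWord_cons τ y V, List.append_right_inj]

open Classical in
-- The Nielsen step. Write `σ x = σ(y) w` and suppose exponents are bounded. Either `w` lies in `I`
-- and serves as a new value of `x`, or `w` is one of finitely many words and `x` disappears. Both
-- reduced equations have finitely many solutions, which contradicts `hinf`.
theorem unboundedPowers_of_longer {I : Set (List C)} (hI : IsCothinIdeal I) {A : Finset X}
    {U V : List (C ⊕ X)} {x : X} {y : C ⊕ X} (hx : x ∈ A) (hV : Sum.inr x ∉ V)
    (hyx : y ≠ Sum.inr x) (hy : ∀ z, y = Sum.inr z → z ∈ A)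
    (hlong : Explodes I A (Sum.inr x :: substWord x [y, Sum.inr x] U) V)
    (hshort : ∀ w : List C, Explodes I (A.erase x)
      (w.map Sum.inl ++ substWord x (y :: w.map Sum.inl) U) V)
    (hinf : {σ ∈ listSol I A (Sum.inr x :: U) (y :: V) | evalWord σ [y] <+: σ x}.Infinite) :
    UnboundedPowers (listSol I A (Sum.inr x :: U) (y :: V)) := by
  by_contra hbdd
  have hev : ∀ (τ : X → List C) (w : List C), evalWord (update τ x w) [y] = evalWord τ [y] :=
    fun τ w => evalWord_update_of_notMem _ (by simpa using hyx.symm)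
  have hfin : ∀ w, {σ ∈ listSol I A (Sum.inr x :: U) (y :: V) |
      σ x = evalWord σ [y] ++ w}.Finite := by
    intro w
    by_contra hT
    apply hbdd
    obtain ⟨σ₀, hσ₀, hσ₀x⟩ := Set.Infinite.nonempty hT
    let f : (X → List C) → X → List C := fun τ =>
      update τ x (evalWord τ (y :: w.map Sum.inl))
    have hinfw : (listSol I (A.erase x)
        (w.map Sum.inl ++ substWord x (y :: w.map Sum.inl) U) V).Infinite := by
      refine Set.Infinite.of_image f (Set.Infinite.mono ?_ hT)
      rintro σ ⟨⟨hσA, hσ, hE⟩, hσx⟩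
      have hf : f (update σ x []) = σ := by
        simp only [f]
        rw [evalWord_cons, hev, evalWord_map_inl, ← hσx]
        simp
      refine ⟨update σ x [], ⟨fun z hz => ?_, fun z hz => ?_, ?_⟩, hf⟩
      · rw [update_of_ne (Finset.ne_of_mem_erase hz)]
        exact hσA z (Finset.mem_of_mem_erase hz)
      · by_cases hzx : z = x
        · subst hzx; simp
        · rw [update_of_ne hzx]
          exact hσ z fun h => hz (Finset.mem_erase.2 ⟨hzx, h⟩)
      · rw [← evalWord_update_eq_iff hyx hV]
        change evalWord (f (update σ x [])) _ = evalWord (f (update σ x [])) _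
        rwa [hf]
    refine (hshort w hinfw).of_mapsTo f ?_ ?_
    · rintro τ ⟨hτA, hτ, hE⟩
      refine ⟨fun z hz => ?_, fun z hz => ?_, (evalWord_update_eq_iff hyx hV).2 hE⟩
      · by_cases hzx : z = x
        · subst hzx
          simp only [f, update_self]
          rw [evalWord_cons, evalWord_map_inl]
          -- If `y` is a variable, the ideal property puts `y w` in `I`. If it is a constant `c`,
          -- the word `c w` is independent of the solution, and `σ₀` shows that it lies in `I`.
          rcases y with c | y
          · have := hσ₀.1 z hx
            rw [hσ₀x] at this
            simpa using this
          · have : τ y ∈ I := hτA y (Finset.mem_erase.2 ⟨by simpa using hyx, hy y rfl⟩)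
            simpa using hI.append_right _ this w
        · simp only [f, update_of_ne hzx]
          exact hτA z (Finset.mem_erase.2 ⟨hzx, hz⟩)
      · have hzx : z ≠ x := by rintro rfl; exact hz hx
        simp only [f, update_of_ne hzx]
        exact hτ z fun h => hz (Finset.mem_of_mem_erase h)
    · rintro τ ⟨-, hτ, -⟩ z
      by_cases hzx : z = x
      · subst hzx
        rw [hτ z (by simp)]
        exact List.nil_infix
      · simp only [f, update_of_ne hzx]
        exact List.infix_refl _
  have hfinI : {σ ∈ listSol I A (Sum.inr x :: U) (y :: V) |
      ∃ w ∈ I, σ x = evalWord σ [y] ++ w}.Finite := by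
    by_contra hT
    apply hbdd
    let f : (X → List C) → X → List C := fun τ =>
      update τ x (evalWord τ [y, Sum.inr x])
    have hinfI : (listSol I A (Sum.inr x :: substWord x [y, Sum.inr x] U) V).Infinite := by
      refine Set.Infinite.of_image f (Set.Infinite.mono ?_ hT)
      rintro σ ⟨⟨hσA, hσ, hE⟩, w, hw, hσx⟩
      have hf : f (update σ x w) = σ := by
        simp only [f]
        rw [evalWord_cons, hev, evalWord_inr_cons, update_self, evalWord_nil, List.append_nil,
          ← hσx]
        simp
      refine ⟨update σ x w, ⟨fun z hz => ?_, fun z hz => ?_, ?_⟩, hf⟩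
      · by_cases hzx : z = x
        · subst hzx; simpa
        · rw [update_of_ne hzx]
          exact hσA z hz
      · rw [update_of_ne (by rintro rfl; exact hz hx)]
        exact hσ z hz
      · refine (evalWord_update_eq_iff (r := [Sum.inr x]) hyx hV).1 ?_
        change evalWord (f (update σ x w)) _ = evalWord (f (update σ x w)) _
        rwa [hf]
    refine (hlong hinfI).of_mapsTo f ?_ ?_
    · rintro τ ⟨hτA, hτ, hE⟩
      refine ⟨fun z hz => ?_, fun z hz => ?_,
        (evalWord_update_eq_iff (r := [Sum.inr x]) hyx hV).2 hE⟩
      · by_cases hzx : z = x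
        · subst hzx
          simp only [f, update_self]
          rw [evalWord_cons]
          simpa using hI.append_left _ _ (hτA z hz)
        · simp only [f, update_of_ne hzx]
          exact hτA z hz
      · simp only [f, update_of_ne (show z ≠ x by rintro rfl; exact hz hx)]
        exact hτ z hz
    · intro τ _ z
      by_cases hzx : z = x
      · subst hzx
        simp only [f, update_self]
        rw [evalWord_cons]
        exact ⟨evalWord τ [y], [], by simp⟩
      · simp only [f, update_of_ne hzx]
        exact List.infix_refl _
  simp only [UnboundedPowers, not_forall, not_exists, not_and] at hbdd
  obtain ⟨k, hk⟩ := hbdd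
  -- A remainder outside `I` with a `k`-th power would give `σ x` one, so only the finitely many
  -- others occur.
  refine hinf (((hI.finite_compl k).biUnion fun w _ => hfin w).union hfinI |>.subset ?_)
  rintro σ ⟨hσ, w, hw⟩
  by_cases hwI : w ∈ I
  · exact Or.inr ⟨hσ, w, hwI, hw.symm⟩
  · refine Or.inl (Set.mem_biUnion (x := w) ⟨hwI, fun hp => hk σ hσ x ?_⟩ ⟨hσ, hw.symm⟩)
    exact hp.of_infix ⟨evalWord σ [y], [], by simpa using hw⟩

end Lists

/-! ### Nielsen transformations on quadratic equations and their termination. -/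

section Induction

variable {C : Type u} {X : Type v}

/-- Every variable occurs at most twice in `U = V`, and only the variables in `A` occur. -/
structure QuadraticOn (A : Finset X) (U V : List (C ⊕ X)) : Prop where
  le_two : ∀ x, occ (Sum.inr x) U + occ (Sum.inr x) V ≤ 2
  eq_zero : ∀ x ∉ A, occ (Sum.inr x) U = 0 ∧ occ (Sum.inr x) V = 0

open Classical in
/-- The number of variables that occur twice on the same side of `U = V`. -/
noncomputable def doubles (A : Finset X) (U V : List (C ⊕ X)) : ℕ :=
  (A.filter fun x => occ (Sum.inr x) U = 2 ∨ occ (Sum.inr x) V = 2).card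

/-- Explosion of all quadratic equations with fewer variables than `A`, or with the variables `A`
and length less than `ℓ`, or with the variables `A`, length `ℓ` and less than `d` doubles. -/
def ExplodesBelow (I : Set (List C)) (A : Finset X) (ℓ d : ℕ) : Prop :=
  ∀ (A' : Finset X) (U V : List (C ⊕ X)), QuadraticOn A' U V →
    (A'.card < A.card ∨ A' = A ∧ (U.length + V.length < ℓ ∨
      U.length + V.length = ℓ ∧ doubles A U V < d)) → Explodes I A' U V

variable {I : Set (List C)} {A : Finset X} {U V : List (C ⊕ X)} {x : X} {y : C ⊕ X} {ℓ d : ℕ}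

theorem QuadraticOn.symm (h : QuadraticOn A U V) : QuadraticOn A V U :=
  ⟨fun x => by rw [add_comm]; exact h.le_two x, fun x hx => (h.eq_zero x hx).symm⟩

theorem doubles_comm (A : Finset X) (U V : List (C ⊕ X)) : doubles A U V = doubles A V U := by
  simp only [doubles, or_comm]

theorem QuadraticOn.mem_left (h : QuadraticOn A (Sum.inr x :: U) V) : x ∈ A := by
  by_contra hx
  have := (h.eq_zero x hx).1
  simp at this

theorem QuadraticOn.of_cons_cons {l : C ⊕ X} (h : QuadraticOn A (l :: U) (l :: V)) :
    QuadraticOn A U V := by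
  refine ⟨fun x => ?_, fun x hx => ?_⟩
  · have := h.le_two x
    simp only [occ_cons] at this
    omega
  · have := h.eq_zero x hx
    simp only [occ_cons] at this
    omega

/-- Apart from the head, `x` occurs at most once in `U`, so at most one new `y` appears, and it
replaces the cancelled head `y`. -/
theorem QuadraticOn.erase [DecidableEq X] (h : QuadraticOn A (Sum.inr x :: U) (y :: V))
    (hyx : y ≠ Sum.inr x) (hV : Sum.inr x ∉ V) (w : List C) :
    QuadraticOn (A.erase x) (w.map Sum.inl ++ substWord x (y :: w.map Sum.inl) U) V := by
  have hV' := occ_eq_zero.2 hV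
  have hx2 := h.le_two x
  simp only [occ_cons_self] at hx2
  have key : ∀ z, occ (Sum.inr z) (w.map Sum.inl ++ substWord x (y :: w.map Sum.inl) U) =
      (if z = x then 0 else occ (Sum.inr z) U) + occ (Sum.inr x) U * occ (Sum.inr z) [y] := by
    intro z
    simp [occ_append, occ_substWord, occ_cons]
  have hyx' : occ (Sum.inr x) [y] = 0 := by rw [occ_cons_of_ne hyx, occ_nil]
  refine ⟨fun z => ?_, fun z hz => ?_⟩
  · rw [key]
    by_cases hzx : z = x
    · subst hzx; simp [hyx', hV']
    · rw [if_neg hzx]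
      have hz2 := h.le_two z
      by_cases hyz : y = Sum.inr z
      · subst hyz
        simp only [occ_cons_self, occ_nil, zero_add, mul_one] at hz2 ⊢
        rw [occ_cons_of_ne (by simpa using Ne.symm hzx)] at hz2
        omega
      · rw [occ_cons_of_ne hyz, occ_cons_of_ne (by simpa using Ne.symm hzx)] at hz2
        rw [occ_cons_of_ne hyz]
        simpa using hz2
  · rw [key]
    by_cases hzx : z = x
    · subst hzx; simp [hyx', hV']
    · rw [if_neg hzx]
      have hz2 := h.eq_zero z fun hzA => hz (Finset.mem_erase.2 ⟨hzx, hzA⟩)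
      have hyz : y ≠ Sum.inr z := by
        rintro rfl
        simp at hz2
      rw [occ_cons_of_ne hyz, occ_cons_of_ne (by simpa using Ne.symm hzx)] at hz2
      rw [occ_cons_of_ne hyz]
      simpa using hz2

theorem occ_longer (hyx : y ≠ Sum.inr x) (z : X) :
    occ (Sum.inr z) (Sum.inr x :: substWord x [y, Sum.inr x] U) =
      occ (Sum.inr z) (Sum.inr x :: U) + occ (Sum.inr x) U * occ (Sum.inr z) [y] := by
  classical
  rw [occ_cons, occ_substWord]
  by_cases hzx : z = x
  · subst hzx
    simp [occ_cons_of_ne hyx]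
  · have hxz : (Sum.inr x : C ⊕ X) ≠ Sum.inr z := by simpa using Ne.symm hzx
    simp [occ_cons, hzx, hxz]

theorem QuadraticOn.longer (h : QuadraticOn A (Sum.inr x :: U) (y :: V))
    (hyx : y ≠ Sum.inr x) :
    QuadraticOn A (Sum.inr x :: substWord x [y, Sum.inr x] U) V := by
  have hx2 := h.le_two x
  simp only [occ_cons_self] at hx2
  refine ⟨fun z => ?_, fun z hz => ?_⟩
  · rw [occ_longer hyx]
    have hz2 := h.le_two z
    by_cases hyz : y = Sum.inr z
    · subst hyz
      simp only [occ_cons_self, occ_nil, zero_add, mul_one] at hz2 ⊢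
      omega
    · rw [occ_cons_of_ne hyz] at hz2 ⊢
      simpa using hz2
  · rw [occ_longer hyx]
    have hz2 := h.eq_zero z hz
    have hyz : y ≠ Sum.inr z := by
      rintro rfl
      simp at hz2
    rw [occ_cons_of_ne hyz] at hz2 ⊢
    simpa using hz2

theorem length_longer :
    (Sum.inr x :: substWord x [y, Sum.inr x] U).length =
      (Sum.inr x :: U : List (C ⊕ X)).length + occ (Sum.inr x) U := by
  have := length_substWord x [y, Sum.inr x] U
  simp only [List.length_cons, List.length_nil] at this ⊢
  omega

/-- Only `y` can gain occurrences on the left, and being absent from `U` it gets at most one there.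
-/
theorem doubles_longer_le (h : QuadraticOn A (Sum.inr x :: U) (y :: V)) (hyx : y ≠ Sum.inr x)
    (hyU : ∀ z, y = Sum.inr z → Sum.inr z ∉ U) :
    doubles A (Sum.inr x :: substWord x [y, Sum.inr x] U) V ≤
      doubles A (Sum.inr x :: U) (y :: V) := by
  classical
  have hx2 := h.le_two x
  simp only [occ_cons_self] at hx2
  refine Finset.card_le_card fun z => ?_
  simp only [Finset.mem_filter, occ_longer hyx]
  rintro ⟨hzA, hz⟩
  refine ⟨hzA, ?_⟩
  by_cases hyz : y = Sum.inr z
  · subst hyz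
    have := occ_eq_zero.2 (hyU z rfl)
    have hz2 := h.le_two z
    simp only [occ_cons_self, occ_nil, zero_add, mul_one, occ_cons_of_ne hyx.symm] at hz hz2 ⊢
    omega
  · simpa [occ_cons_of_ne hyz] using hz

/-- The head `z` is cancelled, so `z` keeps one occurrence on the right and at most one on the left:
it stops being a double, and no double is created. -/
theorem doubles_longer_lt {z : X} (h : QuadraticOn A (Sum.inr x :: U) (Sum.inr z :: V))
    (hzx : z ≠ x) (hzU : Sum.inr z ∉ U) (hzV : occ (Sum.inr z) V = 1) :
    doubles A (Sum.inr x :: substWord x [Sum.inr z, Sum.inr x] U) V <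
      doubles A (Sum.inr x :: U) (Sum.inr z :: V) := by
  classical
  have hyx : (Sum.inr z : C ⊕ X) ≠ Sum.inr x := by simpa using hzx
  have hx2 := h.le_two x
  simp only [occ_cons_self] at hx2
  have hzU' := occ_eq_zero.2 hzU
  refine Finset.card_lt_card (Finset.ssubset_iff_of_subset ?_ |>.2 ⟨z, ?_, ?_⟩)
  · intro t
    simp only [Finset.mem_filter, occ_longer hyx]
    rintro ⟨htA, ht⟩
    refine ⟨htA, ?_⟩
    by_cases hzt : z = t
    · subst hzt
      simp [hzV]
    · have : (Sum.inr z : C ⊕ X) ≠ Sum.inr t := by simpa using hzt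
      simpa [occ_cons_of_ne this] using ht
  · simp only [Finset.mem_filter, occ_cons_self, hzV]
    exact ⟨h.symm.mem_left, by simp⟩
  · simp only [Finset.mem_filter, occ_longer hyx, occ_cons_of_ne hyx.symm, hzU', hzV]
    simp only [occ_cons_self, occ_nil]
    omega

theorem evalWord_cons_ne_nil (hI : IsCothinIdeal I) (h : QuadraticOn A U (y :: V))
    {σ : X → List C} (hσ : ∀ x ∈ A, σ x ∈ I) : evalWord σ (y :: V) ≠ [] := by
  rcases y with c | z
  · simp
  · intro h0
    rw [evalWord_inr_cons, List.append_eq_nil_iff] at h0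
    exact hI.nil_notMem (h0.1 ▸ hσ z h.symm.mem_left)

theorem explodes_cons_nil (hI : IsCothinIdeal I) (h : QuadraticOn A (y :: U) []) :
    Explodes I A (y :: U) [] := by
  intro hinf
  obtain ⟨σ, hσ, -, hE⟩ := hinf.nonempty
  exact absurd hE (evalWord_cons_ne_nil hI h.symm hσ)

theorem explodes_nil_nil (hI : IsCothinIdeal I) :
    Explodes I A ([] : List (C ⊕ X)) [] := by
  intro hinf
  rcases A.eq_empty_or_nonempty with rfl | ⟨x, hx⟩
  -- Without active variables the only candidate is the constantly empty assignment.
  · refine absurd (Set.Subsingleton.finite ?_) hinf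
    rintro σ ⟨-, hσ, -⟩ τ ⟨-, hτ, -⟩
    funext x
    rw [hσ x (by simp), hτ x (by simp)]
  · exact unboundedPowers_of_free hI hx (by simp) (by simp) hinf.nonempty

/-- Here `y V = W x V₂` with `W` starting with `y`, so `W` has nonempty value and can be pumped in
front of `x`. -/
theorem explodes_of_mem_opposite (hI : IsCothinIdeal I)
    (h : QuadraticOn A (Sum.inr x :: U) (y :: V)) (hyx : y ≠ Sum.inr x) (hx : Sum.inr x ∈ V) :
    Explodes I A (Sum.inr x :: U) (y :: V) := by
  intro hinf
  obtain ⟨V₁, V₂, rfl⟩ := List.append_of_mem hx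
  have h2 := h.le_two x
  rw [occ_cons_of_ne hyx] at h2
  simp only [occ_cons_self, occ_append] at h2
  rw [← List.cons_append] at hinf ⊢
  refine unboundedPowers_of_opposite hI h.mem_left (occ_eq_zero.1 (by omega))
    (occ_eq_zero.1 (by omega)) ?_ ?_ hinf.nonempty
  · rw [List.mem_cons, not_or]
    exact ⟨hyx.symm, occ_eq_zero.1 (by omega)⟩
  · rintro σ ⟨hσ, -⟩
    rw [evalWord_cons]
    intro h0
    rw [List.append_eq_nil_iff] at h0
    rcases y with c | z
    · simp at h0
    · rw [evalWord_inr_cons, evalWord_nil, List.append_nil] at h0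
      exact hI.nil_notMem (h0.1 ▸ hσ z h.symm.mem_left)

/-- In a solution of `x U = y V`, one of the words for `x` and `y` is a prefix of the other. -/
theorem explodes_of_split (hI : IsCothinIdeal I) (h : QuadraticOn A (Sum.inr x :: U) (y :: V))
    (h₁ : {σ ∈ listSol I A (Sum.inr x :: U) (y :: V) | evalWord σ [y] <+: σ x}.Infinite →
      UnboundedPowers (listSol I A (Sum.inr x :: U) (y :: V)))
    (h₂ : ∀ z, y = Sum.inr z →
      {σ ∈ listSol I A (y :: V) (Sum.inr x :: U) | evalWord σ [Sum.inr x] <+: σ z}.Infinite →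
      UnboundedPowers (listSol I A (Sum.inr x :: U) (y :: V))) :
    Explodes I A (Sum.inr x :: U) (y :: V) := by
  intro hinf
  by_cases h1 : {σ ∈ listSol I A (Sum.inr x :: U) (y :: V) | evalWord σ [y] <+: σ x}.Infinite
  · exact h₁ h1
  · have hpre : ∀ σ ∈ listSol I A (Sum.inr x :: U) (y :: V),
        evalWord σ [y] <+: σ x ∨ σ x <+: evalWord σ [y] := by
      rintro σ ⟨-, -, hE⟩
      rw [evalWord_inr_cons, evalWord_cons σ y V] at hE
      refine List.prefix_or_prefix_of_prefix (List.prefix_append _ (evalWord σ V)) ?_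
      rw [← hE]
      exact List.prefix_append _ _
    rcases y with c | z
    · refine absurd (hinf.mono fun σ hσ => ?_) h1
      refine ⟨hσ, ?_⟩
      rcases hpre σ hσ with h0 | h0
      · exact h0
      -- A nonempty prefix of a single letter is that letter, so a constant `y` never requires the
      -- second case.
      · have hx : σ x ≠ [] := fun hx => hI.nil_notMem (hx ▸ hσ.1 x h.mem_left)
        have : σ x = evalWord σ [Sum.inl c] := by
          refine h0.eq_of_length_le ?_
          rw [evalWord_inl_cons, evalWord_nil, List.length_singleton]
          exact List.length_pos_iff.2 hx
        rw [this]
    · refine h₂ z rfl fun h2 => hinf ?_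
      refine (Set.Finite.union (Set.not_infinite.1 h1) h2).subset fun σ hσ => ?_
      rcases hpre σ hσ with h0 | h0
      · exact Or.inl ⟨hσ, h0⟩
      · refine Or.inr ⟨?_, by simpa using h0⟩
        rwa [listSol_comm]

/-- Substituting `y x` for `x` cancels the head `y` and inserts one `y` per further `x` in `U`. With
no further `x` the length drops; otherwise it is unchanged and the double `y` is split between the
sides. Substituting `y w` may lengthen the equation but loses a variable. -/
theorem unboundedPowers_of_decreasing (hI : IsCothinIdeal I)
    (hbelow : ExplodesBelow I A ((Sum.inr x :: U).length + (y :: V).length)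
      (doubles A (Sum.inr x :: U) (y :: V)))
    (h : QuadraticOn A (Sum.inr x :: U) (y :: V)) (hyx : y ≠ Sum.inr x) (hV : Sum.inr x ∉ V)
    (hyU : ∀ z, y = Sum.inr z → Sum.inr z ∉ U)
    (hdec : occ (Sum.inr x) U = 0 ∨ ∃ z, y = Sum.inr z ∧ occ (Sum.inr z) V = 1)
    (hinf : {σ ∈ listSol I A (Sum.inr x :: U) (y :: V) | evalWord σ [y] <+: σ x}.Infinite) :
    UnboundedPowers (listSol I A (Sum.inr x :: U) (y :: V)) := by
  classical
  refine unboundedPowers_of_longer hI h.mem_left hV hyx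
    (by rintro z rfl; exact h.symm.mem_left) ?_ (fun w => ?_) hinf
  · refine hbelow A _ _ (h.longer hyx) (Or.inr ⟨rfl, ?_⟩)
    have h2 := h.le_two x
    simp only [occ_cons_self] at h2
    rw [length_longer]
    by_cases h0 : occ (Sum.inr x) U = 0
    · refine Or.inl ?_
      rw [h0, List.length_cons (a := y)]
      omega
    · obtain ⟨z, rfl, hz⟩ := hdec.resolve_left h0
      refine Or.inr ⟨?_, doubles_longer_lt h (by simpa using hyx) (hyU z rfl) hz⟩
      rw [List.length_cons (a := Sum.inr z)]
      omega
  · exact hbelow _ _ _ (h.erase hyx hV w) (Or.inl (Finset.card_erase_lt_of_mem h.mem_left))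

/-- If `x` occurs twice on the left and `y` is not a double, substituting `y x` for `x` preserves
the length, but it shortens `V` and keeps `x` a leading double. Hence the induction on `V`, with `d`
only an upper bound so that it can stay fixed. -/
theorem explodes_of_double_head (hI : IsCothinIdeal I) (hbelow : ExplodesBelow I A ℓ d)
    (V : List (C ⊕ X)) : ∀ U : List (C ⊕ X), QuadraticOn A (Sum.inr x :: U) V →
      occ (Sum.inr x) U = 1 → (Sum.inr x :: U).length + V.length = ℓ →
      doubles A (Sum.inr x :: U) V ≤ d → Explodes I A (Sum.inr x :: U) V := by
  classical
  induction V with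
  | nil => exact fun U h _ _ _ => explodes_cons_nil hI h
  | cons y V ih =>
    intro U h hx hℓ hd
    have hbelow' : ExplodesBelow I A ((Sum.inr x :: U).length + (y :: V).length)
        (doubles A (Sum.inr x :: U) (y :: V)) := by
      rw [hℓ]
      refine fun A' U' V' h' hlt => hbelow A' U' V' h' (hlt.imp_right fun hlt => ?_)
      exact ⟨hlt.1, hlt.2.imp_right fun hlt => ⟨hlt.1, hlt.2.trans_le hd⟩⟩
    have h2 := h.le_two x
    rw [occ_cons_self] at h2
    have hyx : y ≠ Sum.inr x := by
      rintro rfl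
      rw [occ_cons_self] at h2
      omega
    rw [occ_cons_of_ne hyx] at h2
    have hV : Sum.inr x ∉ V := occ_eq_zero.1 (by omega)
    by_cases hyU : ∀ z, y = Sum.inr z → Sum.inr z ∉ U
    swap
    · push Not at hyU
      obtain ⟨z, rfl, hz⟩ := hyU
      exact (explodes_of_mem_opposite hI h.symm hyx.symm hz).symm
    refine explodes_of_split hI h (fun hinf => ?_) ?_
    · by_cases hdec : ∃ z, y = Sum.inr z ∧ occ (Sum.inr z) V = 1
      · exact unboundedPowers_of_decreasing hI hbelow' h hyx hV hyU (Or.inr hdec) hinf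
      · refine unboundedPowers_of_longer hI h.mem_left hV hyx
          (by rintro z rfl; exact h.symm.mem_left) ?_ (fun w => ?_) hinf
        · refine ih _ (h.longer hyx) ?_ ?_ ((doubles_longer_le h hyx hyU).trans hd)
          · have := occ_longer (U := U) hyx x
            rw [occ_cons_self, occ_cons_self, occ_cons_of_ne hyx] at this
            simp at this
            omega
          · rw [length_longer, ← hℓ, List.length_cons (a := y)]
            omega
        · exact hbelow _ _ _ (h.erase hyx hV w)
            (Or.inl (Finset.card_erase_lt_of_mem h.mem_left))
    -- With the roles exchanged, the double `x` gets split, or the length drops.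
    · rintro z rfl hinf
      rw [listSol_comm]
      refine unboundedPowers_of_decreasing hI ?_ h.symm hyx.symm (hyU z rfl) ?_
        (Or.inr ⟨x, rfl, hx⟩) hinf
      · rwa [doubles_comm, add_comm]
      · rintro t ht
        rw [← ht]
        exact hV

theorem explodes_of_below (hI : IsCothinIdeal I) (h : QuadraticOn A U V)
    (hbelow : ExplodesBelow I A (U.length + V.length) (doubles A U V)) : Explodes I A U V := by
  rcases U with - | ⟨l, U⟩
  · rcases V with - | ⟨m, V⟩
    · exact explodes_nil_nil hI
    · exact (explodes_cons_nil hI h.symm).symm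
  rcases V with - | ⟨m, V⟩
  · exact explodes_cons_nil hI h
  by_cases hlm : l = m
  · subst hlm
    have := hbelow A U V h.of_cons_cons (Or.inr ⟨rfl, Or.inl (by simp; omega)⟩)
    unfold Explodes at this ⊢
    rwa [listSol_cons_cons]
  have main : ∀ {x : X} {y : C ⊕ X} {U V : List (C ⊕ X)}, y ≠ Sum.inr x →
      QuadraticOn A (Sum.inr x :: U) (y :: V) →
      ExplodesBelow I A ((Sum.inr x :: U).length + (y :: V).length)
        (doubles A (Sum.inr x :: U) (y :: V)) →
      Explodes I A (Sum.inr x :: U) (y :: V) := by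
    intro x y U V hyx h hbelow
    by_cases hV : Sum.inr x ∈ V
    · exact explodes_of_mem_opposite hI h hyx hV
    by_cases hyU : ∀ z, y = Sum.inr z → Sum.inr z ∉ U
    swap
    · push Not at hyU
      obtain ⟨z, rfl, hz⟩ := hyU
      exact (explodes_of_mem_opposite hI h.symm hyx.symm hz).symm
    have hbelow' := hbelow
    rw [doubles_comm, add_comm] at hbelow'
    have hx2 := h.le_two x
    rw [occ_cons_self] at hx2
    by_cases hx : occ (Sum.inr x) U = 1
    · exact explodes_of_double_head hI hbelow _ _ h hx rfl le_rfl
    refine explodes_of_split hI h (fun hinf => ?_) ?_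
    · exact unboundedPowers_of_decreasing hI hbelow h hyx hV hyU (Or.inl (by omega)) hinf
    · rintro z rfl hinf
      -- A double `z` at the head is the previous lemma with the sides exchanged; otherwise
      -- substituting `x z` for `z` shortens the equation.
      by_cases hz : occ (Sum.inr z) V = 1
      · refine (explodes_of_double_head hI hbelow' _ _ h.symm hz rfl le_rfl).symm ?_
        rw [listSol_comm]
        exact hinf.mono fun σ hσ => hσ.1
      have hz2 := h.le_two z
      rw [occ_cons_self] at hz2
      rw [listSol_comm]
      refine unboundedPowers_of_decreasing hI hbelow' h.symm hyx.symm (hyU z rfl) ?_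
        (Or.inl (by omega)) hinf
      intro t ht
      rwa [← ht]
  rcases l with c | x
  · rcases m with e | y
    · intro hinf
      obtain ⟨σ, -, -, hE⟩ := hinf.nonempty
      refine absurd ?_ hlm
      simp only [evalWord_inl_cons, List.cons.injEq] at hE
      rw [hE.1]
    · refine (main (by simp) h.symm ?_).symm
      rwa [doubles_comm, add_comm]
  · exact main (Ne.symm hlm) h hbelow

/-- A quadratic equation with infinitely many solutions in a cothin ideal has solutions of
arbitrarily large exponent of periodicity. -/
theorem explodes_of_quadraticOn (hI : IsCothinIdeal I) (h : QuadraticOn A U V) :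
    Explodes I A U V := by
  suffices H : ∀ (n ℓ d : ℕ) (A : Finset X) (U V : List (C ⊕ X)), A.card = n →
      U.length + V.length = ℓ → doubles A U V = d → QuadraticOn A U V → Explodes I A U V from
    H _ _ _ A U V rfl rfl rfl h
  intro n
  induction n using Nat.strong_induction_on with
  | _ n ihn =>
  intro ℓ
  induction ℓ using Nat.strong_induction_on with
  | _ ℓ ihℓ =>
  intro d
  induction d using Nat.strong_induction_on with
  | _ d ihd =>
  rintro A U V rfl rfl rfl h
  refine explodes_of_below hI h ?_
  rintro A' U' V' h' (hlt | ⟨rfl, hlt | ⟨heq, hlt⟩⟩)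
  · exact ihn _ hlt _ _ A' U' V' rfl rfl rfl h'
  · exact ihℓ _ hlt _ A' U' V' rfl rfl rfl h'
  · exact ihd _ hlt A' U' V' rfl heq rfl h'

end Induction

/-! ### Eliminating the variables constrained outside the ideal. -/

section Constraints

variable {C : Type u} {X : Type v}

open Classical in
/-- Replace the variables outside `A` by their values under `ρ`. -/
noncomputable def fixWord (A : Finset X) (ρ : X → List C) (w : List (C ⊕ X)) : List (C ⊕ X) :=
  w.flatMap (Sum.elim (fun c => [Sum.inl c])
    fun x => if x ∈ A then [Sum.inr x] else (ρ x).map Sum.inl)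

open Classical in
theorem evalWord_fixWord (A : Finset X) (ρ τ : X → List C) (w : List (C ⊕ X)) :
    evalWord τ (fixWord A ρ w) = evalWord (fun x => if x ∈ A then τ x else ρ x) w := by
  induction w with
  | nil => rfl
  | cons l w ih =>
    have hcons : fixWord A ρ (l :: w) = fixWord A ρ [l] ++ fixWord A ρ w := by simp [fixWord]
    rw [hcons, evalWord_append, ih]
    rcases l with c | x
    · simp [fixWord]
    · by_cases hx : x ∈ A <;> simp [fixWord, hx]

theorem occ_fixWord (A : Finset X) (ρ : X → List C) (w : List (C ⊕ X)) (x : X) :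
    occ (Sum.inr x) (fixWord A ρ w) ≤ occ (Sum.inr x) w ∧
      (x ∉ A → occ (Sum.inr x) (fixWord A ρ w) = 0) := by
  classical
  induction w with
  | nil => simp [fixWord]
  | cons l w ih =>
    have hcons : fixWord A ρ (l :: w) = fixWord A ρ [l] ++ fixWord A ρ w := by simp [fixWord]
    rw [hcons, occ_append, occ_cons]
    have hl : occ (Sum.inr x) (fixWord A ρ [l]) ≤ (if l = Sum.inr x then 1 else 0) ∧
        (x ∉ A → occ (Sum.inr x) (fixWord A ρ [l]) = 0) := by
      rcases l with c | z
      · simp [fixWord, occ_cons]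
      · by_cases hz : z ∈ A
        · by_cases hzx : z = x
          · subst hzx; simp [fixWord, hz]
          · simp [fixWord, hz, occ_cons, hzx]
        · simp [fixWord, hz]
    exact ⟨by omega, fun hx => by rw [hl.2 hx, ih.2 hx]⟩

/-- A quadratic equation whose variables are constrained either to a cothin ideal or to a set
outside it has solutions of unbounded exponent if it has infinitely many solutions. -/
theorem unboundedPowers_of_constraint [Finite X] {I : Set (List C)} (hI : IsCothinIdeal I)
    (K : X → Set (List C)) (hK : ∀ x, K x = I ∨ ∀ w ∈ K x, w ∉ I) {U V : List (C ⊕ X)}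
    (hquad : ∀ x, occ (Sum.inr x) U + occ (Sum.inr x) V ≤ 2)
    (hinf : {σ : X → List C | (∀ x, σ x ∈ K x) ∧ evalWord σ U = evalWord σ V}.Infinite) :
    UnboundedPowers {σ : X → List C | (∀ x, σ x ∈ K x) ∧ evalWord σ U = evalWord σ V} := by
  classical
  have := Fintype.ofFinite X
  by_contra hbdd
  have hbdd' := hbdd
  simp only [UnboundedPowers, not_forall, not_exists, not_and] at hbdd'
  obtain ⟨k, hk⟩ := hbdd'
  let A : Finset X := Finset.univ.filter fun x => K x = I
  have hA : ∀ x, x ∈ A ↔ K x = I := fun x => by simp [A]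
  have hfin : {ρ : X → List C | ∀ x, ρ x ∈ insert [] {w | w ∉ I ∧ ¬ HasPower k w}}.Finite :=
    Set.Finite.pi' fun x => (hI.finite_compl k).insert []
  refine hinf ((hfin.biUnion (t := fun ρ => {σ | ((∀ x, σ x ∈ K x) ∧
    evalWord σ U = evalWord σ V) ∧ ∀ x ∉ A, σ x = ρ x}) fun ρ _ => ?_).subset ?_)
  · by_contra hT
    apply hbdd
    -- `σ₀` certifies that the fixed values `ρ` satisfy the constraints outside `A`.
    obtain ⟨σ₀, ⟨hσ₀, -⟩, hσ₀ρ⟩ := Set.Infinite.nonempty hT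
    let f : (X → List C) → X → List C := fun τ x => if x ∈ A then τ x else ρ x
    have hquad' : QuadraticOn A (fixWord A ρ U) (fixWord A ρ V) := by
      refine ⟨fun x => ?_, fun x hx => ⟨(occ_fixWord A ρ U x).2 hx, (occ_fixWord A ρ V x).2 hx⟩⟩
      have h₁ := (occ_fixWord A ρ U x).1
      have h₂ := (occ_fixWord A ρ V x).1
      have h₃ := hquad x
      omega
    refine (explodes_of_quadraticOn hI hquad' ?_).of_mapsTo f ?_ ?_
    · refine Set.Infinite.of_image f (Set.Infinite.mono ?_ hT)
      rintro σ ⟨⟨hσ, hE⟩, hσρ⟩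
      have hf : f (fun x => if x ∈ A then σ x else []) = σ := by
        funext x
        by_cases hx : x ∈ A
        · simp [f, hx]
        · simp [f, hx, hσρ x hx]
      refine ⟨fun x => if x ∈ A then σ x else [], ⟨fun x hx => ?_, fun x hx => if_neg hx, ?_⟩, hf⟩
      · have := hσ x
        rw [(hA x).1 hx] at this
        simpa [hx] using this
      · rw [evalWord_fixWord, evalWord_fixWord]
        change evalWord (f _) U = evalWord (f _) V
        rwa [hf]
    · rintro τ ⟨hτA, -, hE⟩
      rw [evalWord_fixWord, evalWord_fixWord] at hE
      refine ⟨fun x => ?_, hE⟩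
      by_cases hx : x ∈ A
      · rw [(hA x).1 hx]
        simpa [f, hx] using hτA x hx
      · simpa [f, hx, hσ₀ρ x hx] using hσ₀ x
    · rintro τ ⟨-, hτ, -⟩ x
      by_cases hx : x ∈ A
      · simp [f, hx]
      · rw [hτ x hx]
        exact List.nil_infix
  · rintro σ hσ
    refine Set.mem_biUnion (x := fun x => if x ∈ A then [] else σ x) (fun x => ?_)
      ⟨hσ, fun x hx => by simp [hx]⟩
    by_cases hx : x ∈ A
    · simp [hx]
    · refine Or.inr ?_
      beta_reduce
      rw [if_neg hx]
      have hxI : ¬ K x = I := fun h => hx ((hA x).2 h)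
      exact ⟨(hK x).resolve_left hxI _ (hσ.1 x), hk σ hσ x⟩

end Constraints

/-! ### Words with nonzero image in the Brandt semigroup. -/

section Brandt

variable {C : Type u}

theorem withOne_mul_zero (p : WithOne B2) : p * (B2.zero : WithOne B2) = (B2.zero : WithOne B2) := by
  cases p with
  | one => rfl
  | coe p => rw [← WithOne.coe_mul]; cases p <;> rfl

theorem withOne_zero_mul (p : WithOne B2) : (B2.zero : WithOne B2) * p = (B2.zero : WithOne B2) := by
  cases p with
  | one => rfl
  | coe p => rw [← WithOne.coe_mul]; cases p <;> rfl

/-- The image of a word in `B₂¹`. -/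
def brandtProd (g : C → B2) (w : List C) : WithOne B2 := (w.map fun c => (g c : WithOne B2)).prod

theorem isChain_of_brandtProd_ne_zero {g : C → B2} {w : List C}
    (h : brandtProd g w ≠ (B2.zero : WithOne B2)) :
    w.IsChain fun c d => g c * g d ≠ B2.zero := by
  induction w with
  | nil => simp
  | cons c w ih =>
    have hw : brandtProd g w ≠ (B2.zero : WithOne B2) := by
      intro h0
      apply h
      rw [brandtProd, List.map_cons, List.prod_cons]
      change _ * brandtProd g w = _
      rw [h0, withOne_mul_zero]
    cases w with
    | nil => simp
    | cons d w =>
      refine List.isChain_cons_cons.2 ⟨fun h0 => h ?_, ih hw⟩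
      rw [brandtProd, List.map_cons, List.map_cons, List.prod_cons, List.prod_cons, ← mul_assoc,
        ← WithOne.coe_mul, h0, withOne_zero_mul]

/-- For matrix units, a nonzero product matches the inner indices; these nonvanishing products force
all four indices to agree. -/
theorem eq_of_mul_ne_zero {p q : B2} (hpq : p * q ≠ B2.zero)
    (h : (p * p ≠ B2.zero ∧ (q * p ≠ B2.zero ∨ q * q ≠ B2.zero)) ∨
      (q * q ≠ B2.zero ∧ (p * p ≠ B2.zero ∨ q * p ≠ B2.zero))) :
    p = q ∧ p * p = p ∧ p ≠ B2.zero := by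
  revert p q
  decide

variable {g : C → B2}

/-- Inside a word with nonzero image, letters at distance two coincide. -/
theorem eq_of_isChain_five (hC : ∀ c d e : C, c = d ∨ c = e ∨ d = e)
    (hg : ¬ ∃ e : B2, e * e = e ∧ e ≠ B2.zero ∧ ∀ c, g c = e) {c₀ c₁ c₂ c₃ c₄ : C}
    (h₀ : g c₀ * g c₁ ≠ B2.zero) (h₁ : g c₁ * g c₂ ≠ B2.zero) (h₂ : g c₂ * g c₃ ≠ B2.zero)
    (h₃ : g c₃ * g c₄ ≠ B2.zero) : c₁ = c₃ := by
  by_contra hne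
  have hall : ∀ c, c = c₁ ∨ c = c₃ := fun c => by
    rcases hC c c₁ c₃ with h | h | h
    · exact Or.inl h
    · exact Or.inr h
    · exact absurd h hne
  have key : g c₁ = g c₃ ∧ g c₁ * g c₁ = g c₁ ∧ g c₁ ≠ B2.zero := by
    rcases hall c₂ with rfl | rfl
    · refine eq_of_mul_ne_zero h₂ (Or.inl ⟨h₁, ?_⟩)
      rcases hall c₄ with rfl | rfl
      · exact Or.inl h₃
      · exact Or.inr h₃
    · refine eq_of_mul_ne_zero h₁ (Or.inr ⟨h₂, ?_⟩)
      rcases hall c₀ with rfl | rfl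
      · exact Or.inl h₀
      · exact Or.inr h₀
  refine hg ⟨g c₁, key.2.1, key.2.2, fun c => ?_⟩
  rcases hall c with rfl | rfl
  · rfl
  · exact key.1.symm

/-- The five-letter windows starting at `c` and at `x` show that `x y` is followed by `x y` again.
The letter `c` and one final letter serve only as context, whence `2 * k + 1`. -/
theorem eq_replicate_of_isChain (hC : ∀ c d e : C, c = d ∨ c = e ∨ d = e)
    (hg : ¬ ∃ e : B2, e * e = e ∧ e ≠ B2.zero ∧ ∀ c, g c = e) (k : ℕ) :
    ∀ (c x y : C) (w : List C), (c :: x :: y :: w).IsChain (fun c d => g c * g d ≠ B2.zero) →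
      2 * k + 1 ≤ w.length → ∃ v, x :: y :: w = (List.replicate k [x, y]).flatten ++ v := by
  induction k with
  | zero => exact fun c x y w _ _ => ⟨_, rfl⟩
  | succ k ih =>
    intro c x y w hw hlen
    match w, hlen with
    | z :: u :: t :: w, hlen =>
      have hw' := hw
      simp only [List.isChain_cons_cons] at hw'
      obtain ⟨h₀, h₁, h₂, h₃, h₄, -⟩ := hw'
      obtain rfl := eq_of_isChain_five hC hg h₀ h₁ h₂ h₃
      obtain rfl := eq_of_isChain_five hC hg h₁ h₂ h₃ h₄
      obtain ⟨v, hv⟩ := ih y x y (t :: w) hw.tail.tail (by simp only [List.length_cons] at hlen ⊢; omega)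
      exact ⟨v, by rw [hv, List.replicate_succ]; simp⟩

theorem hasPower_of_brandtProd_ne_zero (hC : ∀ c d e : C, c = d ∨ c = e ∨ d = e)
    (hg : ¬ ∃ e : B2, e * e = e ∧ e ≠ B2.zero ∧ ∀ c, g c = e) {k : ℕ} {w : List C}
    (hw : brandtProd g w ≠ (B2.zero : WithOne B2)) (hlen : 2 * k + 4 ≤ w.length) :
    HasPower k w := by
  match w, hlen with
  | c :: x :: y :: w, hlen =>
    obtain ⟨v, hv⟩ := eq_replicate_of_isChain hC hg k c x y w (isChain_of_brandtProd_ne_zero hw)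
      (by simp only [List.length_cons] at hlen; omega)
    exact ⟨[c], [x, y], v, by simp, by rw [hv]; simp⟩

theorem isCothinIdeal_brandtProd [Finite C] (hC : ∀ c d e : C, c = d ∨ c = e ∨ d = e)
    (hg : ¬ ∃ e : B2, e * e = e ∧ e ≠ B2.zero ∧ ∀ c, g c = e) :
    IsCothinIdeal {w : List C | brandtProd g w = (B2.zero : WithOne B2)} where
  nil_notMem := fun h => WithOne.one_ne_coe h
  append_left u w hw := by
    have hw : brandtProd g w = (B2.zero : WithOne B2) := hw
    change brandtProd g (u ++ w) = _
    rw [brandtProd, List.map_append, List.prod_append]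
    change _ * brandtProd g w = _
    rw [hw, withOne_mul_zero]
  append_right w hw v := by
    have hw : brandtProd g w = (B2.zero : WithOne B2) := hw
    change brandtProd g (w ++ v) = _
    rw [brandtProd, List.map_append, List.prod_append]
    change brandtProd g w * _ = _
    rw [hw, withOne_zero_mul]
  finite_compl k := by
    refine (List.finite_length_lt C (2 * k + 4)).subset ?_
    rintro w ⟨hw, hp⟩
    by_contra hlen
    exact hp (hasPower_of_brandtProd_ne_zero hC hg hw (not_lt.1 hlen))

theorem isCothinIdeal_ne_nil : IsCothinIdeal {w : List C | w ≠ []} where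
  nil_notMem := fun h => h rfl
  append_left u w hw := by
    intro h
    exact hw (List.append_eq_nil_iff.1 h).2
  append_right w hw v := by
    intro h
    exact hw (List.append_eq_nil_iff.1 h).1
  finite_compl k := by
    refine (Set.finite_singleton []).subset ?_
    rintro w ⟨hw, -⟩
    exact not_not.1 hw

end Brandt

/-! ### From free semigroups to lists, and niceness of the Brandt semigroup. -/

section Nice

variable {C : Type u} {X : Type v}

theorem letters_mul {A : Type*} (v w : FreeSemigroup A) :
    letters (v * w) = letters v ++ letters w := by
  simp [letters]

theorem letters_injective {A : Type*} : Injective (letters (A := A)) := by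
  rintro ⟨a, v⟩ ⟨b, w⟩ h
  simpa [letters] using h

theorem letters_ne_nil {A : Type*} (w : FreeSemigroup A) : letters w ≠ [] := by
  simp [letters]

theorem exists_letters_eq {A : Type*} {w : List A} (hw : w ≠ []) :
    ∃ v : FreeSemigroup A, letters v = w := by
  cases w with
  | nil => exact absurd rfl hw
  | cons a w => exact ⟨⟨a, w⟩, rfl⟩

theorem letters_extend (σ : X → FreeSemigroup C) (w : FreeSemigroup (C ⊕ X)) :
    letters (extend σ w) = evalWord (fun x => letters (σ x)) (letters w) := by
  induction w using FreeSemigroup.recOnMul with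
  | ih1 l =>
    rcases l with c | x
    · simp [extend, letters, evalWord]
    · simp [extend, letters, evalWord]
  | ih2 l w h₁ h₂ => rw [map_mul, letters_mul, h₁, h₂, letters_mul, evalWord_append]

theorem coe_map_inl (μ : FreeSemigroup (C ⊕ X) →ₙ* B2) (w : FreeSemigroup C) :
    ((μ (FreeSemigroup.map Sum.inl w) : B2) : WithOne B2) =
      brandtProd (fun c => μ (FreeSemigroup.of (Sum.inl c))) (letters w) := by
  induction w using FreeSemigroup.recOnMul with
  | ih1 c => simp [brandtProd, letters]
  | ih2 c w h₁ h₂ =>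
    rw [map_mul, map_mul, WithOne.coe_mul, h₁, h₂, letters_mul]
    simp [brandtProd]

theorem map_inl_eq_of_const {μ : FreeSemigroup (C ⊕ X) →ₙ* B2} {e : B2} (he : e * e = e)
    (h : ∀ c, μ (FreeSemigroup.of (Sum.inl c)) = e) (w : FreeSemigroup C) :
    μ (FreeSemigroup.map Sum.inl w) = e := by
  induction w using FreeSemigroup.recOnMul with
  | ih1 c => simp [h]
  | ih2 c w h₁ h₂ => rw [map_mul, map_mul, h₁, h₂, he]

open Classical in
theorem WordEquation.IsQuadratic.occ_le {E : WordEquation C X} (h : E.IsQuadratic) (x : X) :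
    occ (Sum.inr x) (letters E.lhs) + occ (Sum.inr x) (letters E.rhs) ≤ 2 := by
  have hocc : ∀ w : List (C ⊕ X), occ (Sum.inr x) w = w.count (Sum.inr x) := by
    intro w
    refine List.countP_congr fun m _ => ?_
    rcases m with c | z
    · exact ⟨fun hm => by simp at hm, fun hm => Bool.noConfusion hm⟩
    · change decide (Sum.inr z = Sum.inr x) = true ↔ decide (z = x) = true
      simp
  rw [hocc, hocc]
  exact h x

theorem le_wordExp {k : ℕ} {w : FreeSemigroup C} (h : HasPower k (letters w)) :
    (k : ℕ∞) ≤ wordExp w :=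
  le_iSup₂ (f := fun (n : ℕ) (_ : n ∈ {n : ℕ | ∃ u p v : List C, p ≠ [] ∧
    letters w = u ++ (List.replicate n p).flatten ++ v}) => (n : ℕ∞)) k h

theorem eqExp_eq_top_of_unboundedPowers {S : Type*} [Semigroup S] {E : WordEquation C X}
    {μ : FreeSemigroup (C ⊕ X) →ₙ* S}
    (h : UnboundedPowers ((fun σ x => letters (σ x)) '' Sol E μ)) : eqExp E μ = ⊤ := by
  refine ENat.eq_top_iff_forall_ge.2 fun k => ?_
  obtain ⟨-, ⟨σ, hσ, rfl⟩, x, hx⟩ := h k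
  calc (k : ℕ∞) ≤ wordExp (σ x) := le_wordExp hx
    _ ≤ solExp σ := le_iSup (fun x => wordExp (σ x)) x
    _ ≤ eqExp E μ := le_iSup₂ (f := fun σ (_ : σ ∈ Sol E μ) => solExp σ) σ hσ

theorem eq_or_eq_of_card_le_two [Finite C] (h : ENat.card C ≤ 2) (c d e : C) :
    c = d ∨ c = e ∨ d = e := by
  have := Fintype.ofFinite C
  rw [ENat.card_eq_coe_fintype_card] at h
  by_contra! hne
  have : 2 < Fintype.card C := Fintype.two_lt_card_iff.2 ⟨c, d, e, hne⟩
  have h' : Fintype.card C ≤ 2 := by exact_mod_cast h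
  omega

/-- The solutions as assignments of lists. -/
theorem image_letters_sol {S : Type*} [Semigroup S] (E : WordEquation C X)
    (μ : FreeSemigroup (C ⊕ X) →ₙ* S) :
    (fun (σ : X → FreeSemigroup C) x => letters (σ x)) '' Sol E μ =
      {σ | (∀ x, σ x ∈ letters '' {w : FreeSemigroup C |
        μ (FreeSemigroup.map Sum.inl w) = μ (FreeSemigroup.of (Sum.inr x))}) ∧
        evalWord σ (letters E.lhs) = evalWord σ (letters E.rhs)} := by
  ext τ
  constructor
  · rintro ⟨σ, ⟨hE, hσ⟩, rfl⟩
    refine ⟨fun x => ⟨σ x, hσ x, rfl⟩, ?_⟩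
    rw [← letters_extend, ← letters_extend, hE]
  · rintro ⟨hτ, hE⟩
    choose σ hσ hστ using hτ
    obtain rfl : (fun x => letters (σ x)) = τ := funext hστ
    refine ⟨σ, ⟨letters_injective ?_, hσ⟩, rfl⟩
    rw [letters_extend, letters_extend, hE]

theorem isNice_B2 : IsNice.{u, v, 0} B2 quadraticTwoConstants.{u, v} := by
  intro C X _ _ E hE μ hinf
  obtain ⟨hquad, hcard⟩ := hE
  have hC := eq_or_eq_of_card_le_two hcard
  obtain ⟨σ₀, hσ₀⟩ := hinf.nonempty
  have hinf' : ((fun (σ : X → FreeSemigroup C) x => letters (σ x)) '' Sol E μ).Infinite :=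
    hinf.image (Injective.injOn fun σ τ h => funext fun x => letters_injective (congrFun h x))
  apply eqExp_eq_top_of_unboundedPowers
  rw [image_letters_sol] at hinf' ⊢
  by_cases hg : ∃ e : B2, e * e = e ∧ e ≠ B2.zero ∧ ∀ c, μ (FreeSemigroup.of (Sum.inl c)) = e
  · obtain ⟨e, he, -, hμ⟩ := hg
    refine unboundedPowers_of_constraint isCothinIdeal_ne_nil _ (fun x => Or.inl ?_)
      hquad.occ_le hinf'
    -- The existence of a solution forces the image of `x`, so every nonempty word is allowed.
    have hx : μ (FreeSemigroup.of (Sum.inr x)) = e := by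
      rw [← hσ₀.2 x, map_inl_eq_of_const he hμ]
    ext w
    constructor
    · rintro ⟨v, -, rfl⟩
      exact letters_ne_nil v
    · intro hw
      obtain ⟨v, rfl⟩ := exists_letters_eq hw
      exact ⟨v, by rw [Set.mem_ofPred_eq, hx, map_inl_eq_of_const he hμ], rfl⟩
  · refine unboundedPowers_of_constraint (isCothinIdeal_brandtProd hC hg) _ (fun x => ?_)
      hquad.occ_le hinf'
    by_cases hx : μ (FreeSemigroup.of (Sum.inr x)) = B2.zero
    · left
      ext w
      constructor
      · rintro ⟨v, hv, rfl⟩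
        rw [Set.mem_ofPred_eq, ← coe_map_inl, hv, hx]
      · intro hw
        have hw : brandtProd _ w = _ := hw
        obtain ⟨v, rfl⟩ := exists_letters_eq (w := w) (by
          rintro rfl
          exact WithOne.one_ne_coe hw)
        rw [← coe_map_inl, WithOne.coe_inj] at hw
        exact ⟨v, hw.trans hx.symm, rfl⟩
    · right
      rintro - ⟨v, hv, rfl⟩ hw
      have hw : brandtProd _ (letters v) = _ := hw
      rw [← coe_map_inl, WithOne.coe_inj] at hw
      exact hx (hv.symm.trans hw)

end Nice

/-! ### Failure of the third DLG condition. -/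

section NotDLG

theorem not_isDLG_B2 : ¬ IsDLG B2 := by
  intro h
  -- Since `a(ba) = a`, the elements `ba` and `a` generate the same left ideal.
  have hL : GreenL B2.ba B2.a := by
    refine Set.Subset.antisymm ?_ ?_
    · rintro _ ⟨s, rfl⟩
      exact ⟨s * (B2.b : WithOne B2), mul_assoc _ _ _⟩
    · rintro _ ⟨s, rfl⟩
      exact ⟨s * (B2.a : WithOne B2), mul_assoc _ _ _⟩
  have hmem : omegaPow (B2.b : WithOne B2) * (B2.a : WithOne B2) = (B2.a : WithOne B2) :=
    h.mem_of_greenL B2.a B2.ba (B2.b : WithOne B2) rfl hL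
  have hsq : (B2.b : WithOne B2) * (B2.b : WithOne B2) = (B2.zero : WithOne B2) := rfl
  have hpow : omegaPow (B2.b : WithOne B2) = (B2.zero : WithOne B2) := by
    have hs : 2 ∈ {n : ℕ | 0 < n ∧ IsIdempotentElem ((B2.b : WithOne B2) ^ n)} := by
      refine ⟨by norm_num, ?_⟩
      rw [pow_two, hsq]
      rfl
    obtain ⟨hpos, hidem⟩ := Nat.sInf_mem ⟨2, hs⟩
    unfold omegaPow
    generalize sInf {n : ℕ | 0 < n ∧ IsIdempotentElem ((B2.b : WithOne B2) ^ n)} = n at hpos hidem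
    -- The element `b` is not idempotent and all its higher powers are 0.
    match n, hpos with
    | 1, _ =>
      rw [pow_one, IsIdempotentElem, hsq, WithOne.coe_inj] at hidem
      exact absurd hidem (by decide)
    | n + 2, _ => rw [pow_add, pow_two, hsq, withOne_mul_zero]
  rw [hpow, withOne_zero_mul, WithOne.coe_inj] at hmem
  exact absurd hmem (by decide)

end NotDLG

end WordEq

theorem mainTheorem4 :
    ¬ WordEq.IsDLG WordEq.B2 ∧
      WordEq.IsNice.{u, v, 0} WordEq.B2 WordEq.quadraticTwoConstants.{u, v} :=
  ⟨WordEq.not_isDLG_B2, WordEq.isNice_B2⟩
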